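/- All graphs are finite and simple. For a connected graph $G$ with at least three vertices, let $rx_3(G)$ be the least number of colours in an edge-colouring of $G$ (adjacent edges may have the same colour) such that every set $S$ of three vertices of $G$ is contained in the vertex set of a tree in $G$ whose edges have pairwise distinct colours. Let $sdiam_3(G)$ be the maximum, over all sets $S$ of three vertices of $G$, of the minimum number of edges of a tree in $G$ containing $S$. For a family $\mathcal F$ of graphs, $G$ is $\mathcal F$-free if no induced subgraph of $G$ is isomorphic to a member of $\mathcal F$. Let $P_n$ be the path on $n$ vertices, $K_{1,r}$ the star with $r$ edges, and $K_s^h$ the graph obtained from the complete graph $K_s$ by attaching one pendant edge to each of its vertices. Theorem 8. Let $\mathcal F$ be a family of three pairwise non-isomorphic connected graphs, each with at least three vertices, such that (up to isomorphism) $P_3\notin\mathcal F$ and there is no $r\ge 3$ with $\{K_{1,r},P_4\}\subseteq\mathcal F$. Then there is a constant $C_{\mathcal F}$ such that every connected $\mathcal F$-free graph $G$ with at least three vertices satisfies $$rx_3(G)\le sdiam_3(G)+C_{\mathcal F}$$ if and only if (up to isomorphism) $\mathcal F=\{K_{1,r},Y,P_\ell\}$ for some integers $r\ge 3$ and $\ell>4$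 and some graph $Y$ that is an induced subgraph of $K_s^h$ for some $s\ge 3$. -/

import Mathlib

namespace RainbowIndex

universe u v

/-- An `S`-tree of `G`: a subgraph of `G` that is a tree and contains all vertices of `S`. -/
def IsSTree {V : Type u} {G : SimpleGraph V} (T : G.Subgraph) (S : Finset V) : Prop :=
  T.coe.IsTree ∧ ∀ v ∈ S, v ∈ T.verts

/-- No two distinct edges of `T` have the same colour under the edge-colouring `c` of `G`. -/
def IsRainbow {V : Type u} {G : SimpleGraph V} {K : Type v} (c : G.edgeSet → K)
    (T : G.Subgraph) : Prop :=
  ∀ e f : G.edgeSet, (e : Sym2 V) ∈ T.edgeSet → (f : Sym2 V) ∈ T.edgeSet → c e = c f → e = f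

/-- A `k`-rainbow colouring: for every set `S` of `k` vertices there is a rainbow `S`-tree. -/
def IsRainbowColoring {V : Type u} {G : SimpleGraph V} {K : Type v} (k : ℕ)
    (c : G.edgeSet → K) : Prop :=
  ∀ S : Finset V, S.card = k → ∃ T : G.Subgraph, IsSTree T S ∧ IsRainbow c T

/-- The `k`-rainbow index `rx_k(G)`: the least number of colours of a `k`-rainbow colouring
of `G`. For a finite connected graph such colourings exist (give all edges distinct colours). -/
noncomputable def rainbowIndex {V : Type u} (G : SimpleGraph V) (k : ℕ) : ℕ :=
  sInf {t : ℕ | ∃ c : G.edgeSet → Fin t, IsRainbowColoring k c}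

/-- The Steiner distance `d(S)`: the least number of edges of an `S`-tree of `G`. -/
noncomputable def steinerDist {V : Type u} (G : SimpleGraph V) (S : Finset V) : ℕ :=
  sInf {m : ℕ | ∃ T : G.Subgraph, IsSTree T S ∧ T.edgeSet.ncard = m}

/-- The `k`-Steiner diameter `sdiam_k(G)`: the largest Steiner distance of a set of `k`
vertices of the finite graph `G`. -/
noncomputable def steinerDiam {V : Type u} [Fintype V] (G : SimpleGraph V) (k : ℕ) : ℕ :=
  (Finset.univ.powersetCard k).sup (steinerDist G)

/-- The star `K_{1,r}`. -/
abbrev star (r : ℕ) : SimpleGraph (Fin 1 ⊕ Fin r) :=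
  completeBipartiteGraph (Fin 1) (Fin r)

/-- The graph `K_s^h`: the complete graph on `s` vertices (`Sum.inl`) with one pendant edge
attached to each of them (the other ends being the `Sum.inr` vertices). -/
def hairyComplete (s : ℕ) : SimpleGraph (Fin s ⊕ Fin s) where
  Adj
    | .inl a, .inl b => a ≠ b
    | .inl a, .inr b => a = b
    | .inr a, .inl b => a = b
    | .inr _, .inr _ => False
  symm := ⟨by
    rintro (a | a) (b | b) h
    · exact Ne.symm h
    · exact Eq.symm h
    · exact Eq.symm h
    · exact h⟩
  loopless := ⟨by
    rintro (a | a) h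
    · exact h rfl
    · exact h⟩

/-- Some member of the family `F` is isomorphic to `H`. -/
def HasMember {ι : Type} {V : ι → Type u} (F : ∀ i, SimpleGraph (V i))
    {W : Type v} (H : SimpleGraph W) : Prop :=
  ∃ i, Nonempty (F i ≃g H)

/-- `G` is `F`-free: no member of `F` is isomorphic to an induced subgraph of `G`. -/
def IsFree {ι : Type} {V : ι → Type u} (F : ∀ i, SimpleGraph (V i))
    {W : Type v} (G : SimpleGraph W) : Prop :=
  ∀ i, ¬ (F i).IsIndContained G

/-- There is a constant `C` with `rx_3(G) ≤ sdiam_3(G) + C` for every finite connected `F`-free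
graph `G` (with at least three vertices, as `rx_3` and `sdiam_3` presuppose). -/
def HasRainbowBound {ι : Type} {V : ι → Type u} (F : ∀ i, SimpleGraph (V i)) : Prop :=
  ∃ C : ℕ, ∀ (W : Type) [Fintype W] (G : SimpleGraph W),
    3 ≤ Fintype.card W → G.Connected → IsFree F G →
      rainbowIndex G 3 ≤ steinerDiam G 3 + C

end RainbowIndex

namespace RainbowIndex

open SimpleGraph

universe u v

/-! Necessity rests on three families of test graphs on which `rx_3 - sdiam_3` is unbounded. In
`K_{1,n}` and `K_n^h` the pendant edges need pairwise distinct colours while the Steiner diameter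
stays bounded; in the cycle on `3m` vertices `sdiam_3` is at most `2m` but `rx_3` is at least `3m -
2`. So some member of the family embeds in a large star, some member in a large `K_n^h`, and some
member in a long cycle. Being connected, these are respectively a star, an induced subgraph of
`K_n^h`, and a path. The excluded cases make the star contain a claw and the path have at least five
vertices, which forces the three members to be different, so they are the whole family.

For sufficiency, `rx_3` itself is bounded. Without a long induced path the diameter is bounded;
Ramsey's theorem applied to a minimal dominating set then bounds every independent set
(`exists_indep_bound_ball`). Three disjoint independent sets, each maximal outside the earlier ones,
form a bounded set `J` such that each vertex outside has three distinct neighbours in `J`. A bounded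
walk through `J` with all its edges coloured differently, plus three colours for the edges to the
chosen neighbours, is enough (`rainbowIndex_le_of_walk`). -/

/-! ### Steiner trees, walks and elementary bounds -/

/-- A connected subgraph has a spanning tree. -/
theorem exists_isTree_le {V : Type u} {G : SimpleGraph V} (H : G.Subgraph)
    (hH : H.Connected) : ∃ T ≤ H, T.verts = H.verts ∧ T.coe.IsTree := by
  obtain ⟨T₀, hle, hT⟩ := hH.coe.exists_isTree_le
  let T : G.Subgraph :=
    { verts := H.verts
      Adj := fun a b => ∃ (ha : a ∈ H.verts) (hb : b ∈ H.verts), T₀.Adj ⟨a, ha⟩ ⟨b, hb⟩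
      adj_sub := fun ⟨_, _, h⟩ => H.adj_sub (hle h)
      edge_vert := fun ⟨ha, _, _⟩ => ha
      symm := ⟨fun _ _ ⟨ha, hb, h⟩ => ⟨hb, ha, h.symm⟩⟩ }
  refine ⟨T, ⟨subset_rfl, fun a b ⟨_, _, h⟩ => hle h⟩, rfl, ?_⟩
  have : T.coe = T₀ := by
    ext a b
    exact ⟨fun ⟨_, _, h⟩ => h, fun h => ⟨a.2, b.2, h⟩⟩
  rw [this]
  exact hT

theorem exists_isSTree_le {V : Type u} {G : SimpleGraph V} {H : G.Subgraph}
    (hH : H.Connected) {S : Finset V} (hS : ∀ s ∈ S, s ∈ H.verts) :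
    ∃ T ≤ H, IsSTree T S := by
  obtain ⟨T, hle, hv, hT⟩ := exists_isTree_le H hH
  exact ⟨T, hle, hT, fun s hs => hv ▸ hS s hs⟩

/-- A walk through `S` bounds the Steiner distance of `S`. -/
theorem steinerDist_le_length {V : Type u} {G : SimpleGraph V} {a b : V}
    (p : G.Walk a b) {S : Finset V} (hS : ∀ s ∈ S, s ∈ p.support) :
    steinerDist G S ≤ p.length := by
  classical
  obtain ⟨T, hle, hT⟩ := exists_isSTree_le (S := S) p.toSubgraph_connected
    (fun s hs => p.mem_verts_toSubgraph.2 (hS s hs))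
  have hdist : steinerDist G S ≤ T.edgeSet.ncard := Nat.sInf_le ⟨T, hT, rfl⟩
  refine hdist.trans ?_
  have hsub : T.edgeSet ⊆ (p.edges.toFinset : Set (Sym2 V)) := fun e he => by
    have := Subgraph.edgeSet_mono hle he
    rw [Walk.edgeSet_toSubgraph] at this
    simpa using this
  calc T.edgeSet.ncard ≤ (p.edges.toFinset : Set (Sym2 V)).ncard :=
        Set.ncard_le_ncard hsub (Finset.finite_toSet _)
    _ = p.edges.toFinset.card := Set.ncard_coe_finset _
    _ ≤ p.edges.length := List.toFinset_card_le _
    _ = p.length := p.length_edges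

/-- In a graph where any two vertices are joined by a walk of length at most `d`, any finite
set of vertices lies on a walk of length at most `d` times its size. -/
theorem exists_walk_through {V : Type u} {G : SimpleGraph V} {d : ℕ}
    (hd : ∀ a b, ∃ p : G.Walk a b, p.length ≤ d) (J : Finset V) (x : V) :
    ∃ (y : V) (p : G.Walk x y), (∀ j ∈ J, j ∈ p.support) ∧ p.length ≤ J.card * d := by
  classical
  induction J using Finset.induction_on with
  | empty => exact ⟨x, Walk.nil, by simp, by simp⟩
  | insert j J hj ih =>
    obtain ⟨y, p, hp, hl⟩ := ih
    obtain ⟨q, hq⟩ := hd y j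
    refine ⟨j, p.append q, fun i hi => ?_, ?_⟩
    · rw [Walk.mem_support_append_iff]
      rcases Finset.mem_insert.1 hi with rfl | hi
      · exact Or.inr q.end_mem_support
      · exact Or.inl (hp i hi)
    · rw [Walk.length_append, Finset.card_insert_of_notMem hj, add_mul, one_mul]
      omega

theorem steinerDiam_le {V : Type u} [Fintype V] {G : SimpleGraph V} {k m : ℕ}
    (h : ∀ S : Finset V, S.card = k → steinerDist G S ≤ m) : steinerDiam G k ≤ m :=
  Finset.sup_le fun S hS => h S (Finset.mem_powersetCard.1 hS).2

theorem steinerDiam_le_of_walk {V : Type u} [Fintype V] {G : SimpleGraph V} {d k : ℕ}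
    (hk : k ≠ 0) (hd : ∀ a b, ∃ p : G.Walk a b, p.length ≤ d) : steinerDiam G k ≤ k * d := by
  refine steinerDiam_le fun S hS => ?_
  obtain ⟨x, -⟩ := Finset.card_pos.1 (by omega : 0 < S.card)
  obtain ⟨y, p, hp, hl⟩ := exists_walk_through hd S x
  exact (steinerDist_le_length p hp).trans (hS ▸ hl)

theorem rainbowIndex_le_card {V : Type u} {G : SimpleGraph V} {K : Type v} [Fintype K] {k : ℕ}
    (c : G.edgeSet → K) (hc : IsRainbowColoring k c) : rainbowIndex G k ≤ Fintype.card K := by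
  refine Nat.sInf_le ⟨Fintype.equivFin K ∘ c, fun S hS => ?_⟩
  obtain ⟨T, hT, h⟩ := hc S hS
  exact ⟨T, hT, fun e f he hf hef => h e f he hf ((Fintype.equivFin K).injective hef)⟩

/-- A finite connected graph has a rainbow colouring with `rainbowIndex` colours. -/
theorem exists_isRainbowColoring {V : Type u} [Finite V] {G : SimpleGraph V}
    (hG : G.Connected) (k : ℕ) :
    ∃ c : G.edgeSet → Fin (rainbowIndex G k), IsRainbowColoring k c := by
  have : Fintype G.edgeSet := Fintype.ofFinite _
  refine Nat.sInf_mem (s := {t : ℕ | ∃ c : G.edgeSet → Fin t, IsRainbowColoring k c})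
    ⟨_, Fintype.equivFin G.edgeSet, fun S _ => ?_⟩
  have htop : (⊤ : G.Subgraph).Connected :=
    ⟨(Subgraph.topIso (G := G)).connected_iff.2 hG⟩
  obtain ⟨T, -, hT⟩ := exists_isSTree_le (S := S) htop (fun s _ => trivial)
  exact ⟨T, hT, fun e f _ _ hef => (Fintype.equivFin _).injective hef⟩

/-- A connected graph with a walk through `J` such that every vertex outside `J` has three
distinct neighbours in `J`. -/
theorem rainbowIndex_le_of_walk {V : Type u} {G : SimpleGraph V} {a b : V} (p : G.Walk a b)
    {J : Finset V} (hJ : ∀ j ∈ J, j ∈ p.support) (n : Fin 3 → V → V)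
    (hadj : ∀ i, ∀ v ∉ J, G.Adj v (n i v)) (hmem : ∀ i, ∀ v ∉ J, n i v ∈ J)
    (hne : ∀ i j, ∀ v ∉ J, n i v = n j v → i = j) :
    rainbowIndex G 3 ≤ p.length + 3 := by
  classical
  -- An edge of `p` is coloured by its first position in `p`, and an edge from `v` to `n i v` off
  -- the walk by `i`. The last value, `.inr 0`, goes to edges that are never used.
  let c : G.edgeSet → Fin p.edges.length ⊕ Fin 3 := fun e =>
    if h : (e : Sym2 V) ∈ p.edges then .inl ⟨p.edges.idxOf (e : Sym2 V), List.idxOf_lt_length_iff.2 h⟩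
    else if h : ∃ i, ∃ v, v ∉ J ∧ (e : Sym2 V) = s(v, n i v) then .inr h.choose else .inr 0
  have hc₁ : ∀ (e : G.edgeSet) (h : (e : Sym2 V) ∈ p.edges),
      c e = .inl ⟨p.edges.idxOf (e : Sym2 V), List.idxOf_lt_length_iff.2 h⟩ :=
    fun e h => dif_pos h
  have hc₂ : ∀ e : G.edgeSet, (e : Sym2 V) ∉ p.edges → ∀ i, ∀ v ∉ J, (e : Sym2 V) = s(v, n i v) →
      c e = .inr i := by
    intro e h i v hv he
    have hex : ∃ i, ∃ v, v ∉ J ∧ (e : Sym2 V) = s(v, n i v) := ⟨i, v, hv, he⟩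
    have : c e = .inr hex.choose := (dif_neg h).trans (dif_pos hex)
    rw [this]
    obtain ⟨w, hw, hew⟩ := hex.choose_spec
    -- The colour does not depend on the choice: only one end of the edge is outside `J`, which
    -- fixes `v`, and then `hne` fixes `i`.
    rcases Sym2.eq_iff.1 (he.symm.trans hew) with ⟨rfl, h⟩ | ⟨h, -⟩
    · rw [hne _ _ v hv h]
    · exact absurd (h ▸ hmem _ w hw) hv
  have key : IsRainbowColoring 3 c := by
    intro S hS
    let x : Fin 3 → V := fun i => (S.equivFinOfCardEq hS).symm i
    have hx : ∀ s ∈ S, ∃ i, x i = s := fun s hs =>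
      ⟨S.equivFinOfCardEq hS ⟨s, hs⟩, by simp [x]⟩
    -- The `i`-th vertex of `S` is attached by its edge of colour `i`, so each of the three extra
    -- colours is used at most once.
    have step : ∀ (H : G.Subgraph) (i : Fin 3), H.Connected → p.toSubgraph ≤ H →
        ∃ H', H ≤ H' ∧ H'.Connected ∧ x i ∈ H'.verts ∧
          ∀ e ∈ H'.edgeSet, e ∈ H.edgeSet ∨ (x i ∉ J ∧ e = s(x i, n i (x i))) := by
      intro H i hH hp
      by_cases hi : x i ∈ J
      · exact ⟨H, le_rfl, hH, hp.1 (p.mem_verts_toSubgraph.2 (hJ _ hi)), fun e he => .inl he⟩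
      · refine ⟨H ⊔ G.subgraphOfAdj (hadj i _ hi), le_sup_left,
          Subgraph.connected_sup hH.preconnected (Subgraph.subgraphOfAdj_connected _).preconnected
            ⟨n i (x i), hp.1 (p.mem_verts_toSubgraph.2 (hJ _ (hmem i _ hi))), by simp⟩,
          .inr (by simp), fun e he => ?_⟩
        rw [Subgraph.edgeSet_sup, edgeSet_subgraphOfAdj] at he
        exact he.imp id fun h => ⟨hi, h⟩
    obtain ⟨H₀, hle₀, hH₀, hx₀, he₀⟩ := step p.toSubgraph 0 p.toSubgraph_connected le_rfl
    obtain ⟨H₁, hle₁, hH₁, hx₁, he₁⟩ := step H₀ 1 hH₀ hle₀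
    obtain ⟨H₂, hle₂, hH₂, hx₂, he₂⟩ := step H₁ 2 hH₁ (hle₀.trans hle₁)
    obtain ⟨T, hT, hST⟩ := exists_isSTree_le (S := S) hH₂ (fun s hs => by
      obtain ⟨i, rfl⟩ := hx s hs
      fin_cases i
      exacts [hle₂.1 (hle₁.1 hx₀), hle₂.1 hx₁, hx₂])
    have hE : ∀ e ∈ T.edgeSet, e ∈ p.edges ∨ ∃ i, x i ∉ J ∧ e = s(x i, n i (x i)) := by
      intro e he
      rcases he₂ e (Subgraph.edgeSet_mono hT he) with he | he
      · rcases he₁ e he with he | he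
        · rcases he₀ e he with he | he
          · rw [Walk.edgeSet_toSubgraph] at he
            exact .inl he
          · exact .inr ⟨0, he⟩
        · exact .inr ⟨1, he⟩
      · exact .inr ⟨2, he⟩
    refine ⟨T, hST, fun e f he hf hef => ?_⟩
    by_cases hpe : (e : Sym2 V) ∈ p.edges
    · by_cases hpf : (f : Sym2 V) ∈ p.edges
      · rw [hc₁ e hpe, hc₁ f hpf] at hef
        exact Subtype.ext ((List.idxOf_inj hpe).1 (Fin.mk.inj (Sum.inl.inj hef)))
      · obtain ⟨j, hj, hfj⟩ := (hE f hf).resolve_left hpf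
        rw [hc₁ e hpe, hc₂ f hpf j _ hj hfj] at hef
        exact (Sum.inl_ne_inr hef).elim
    · obtain ⟨i, hi, hei⟩ := (hE e he).resolve_left hpe
      rw [hc₂ e hpe i _ hi hei] at hef
      by_cases hpf : (f : Sym2 V) ∈ p.edges
      · rw [hc₁ f hpf] at hef
        exact (Sum.inl_ne_inr hef.symm).elim
      · obtain ⟨j, hj, hfj⟩ := (hE f hf).resolve_left hpf
        rw [hc₂ f hpf j _ hj hfj] at hef
        obtain rfl := Sum.inr.inj hef
        exact Subtype.ext (hei.trans hfj.symm)
  simpa using rainbowIndex_le_card c key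

/-! ### Independent sets and the upper bound on the rainbow index -/

/-- Ramsey's theorem for two colours. -/
theorem exists_clique_or_indep {V : Type u} (G : SimpleGraph V) (a b : ℕ) (A : Finset V)
    (hA : 2 ^ (a + b) ≤ A.card) :
    (∃ B ⊆ A, B.card = a ∧ G.IsClique (B : Set V)) ∨
      ∃ B ⊆ A, B.card = b ∧ G.IsIndepSet (B : Set V) := by
  classical
  induction h : a + b generalizing a b A with
  | zero => exact .inl ⟨∅, by simp, by simp; omega, by simp⟩
  | succ m ih =>
    rcases Nat.eq_zero_or_pos a with rfl | ha
    · exact .inl ⟨∅, by simp, by simp, by simp⟩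
    rcases Nat.eq_zero_or_pos b with rfl | hb
    · exact .inr ⟨∅, by simp, by simp, by simp⟩
    rw [h, pow_succ] at hA
    obtain ⟨x, hx⟩ : A.Nonempty := Finset.card_pos.1 (by have := Nat.one_le_two_pow (n := m); omega)
    have hsplit := Finset.card_filter_add_card_filter_not (s := A.erase x) (fun y => G.Adj x y)
    rw [Finset.card_erase_of_mem hx] at hsplit
    have hxmem : ∀ (P : V → Prop) [DecidablePred P] (B : Finset V),
        B ⊆ (A.erase x).filter P → x ∉ B ∧ insert x B ⊆ A ∧ ∀ y ∈ B, P y := by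
      intro P _ B hB
      refine ⟨fun hxB => by simpa using hB hxB, ?_, fun y hy => (Finset.mem_filter.1 (hB hy)).2⟩
      exact Finset.insert_subset hx
        ((hB.trans (Finset.filter_subset _ _)).trans (Finset.erase_subset _ _))
    -- At least `2 ^ (m + 1) - 1` vertices remain besides `x`, so its neighbours or its
    -- non-neighbours number at least `2 ^ m`.
    by_cases hcard : 2 ^ m ≤ ((A.erase x).filter (fun y => G.Adj x y)).card
    · rcases ih (a - 1) b _ (by rwa [show a - 1 + b = m by omega]) (by omega) with
        ⟨B, hB, hBc, hcl⟩ | ⟨B, hB, hBc, hcl⟩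
      · obtain ⟨h₁, h₂, h₃⟩ := hxmem _ B hB
        refine .inl ⟨insert x B, h₂, by rw [Finset.card_insert_of_notMem h₁]; omega, ?_⟩
        rw [Finset.coe_insert, isClique_insert]
        exact ⟨hcl, fun y hy _ => h₃ y hy⟩
      · exact .inr ⟨B, fun y hy => (hxmem _ B hB).2.1 (Finset.mem_insert_of_mem hy), hBc, hcl⟩
    · have hcard' : 2 ^ m ≤ ((A.erase x).filter (fun y => ¬ G.Adj x y)).card := by omega
      rcases ih a (b - 1) _ (by rwa [show a + (b - 1) = m by omega]) (by omega) with
        ⟨B, hB, hBc, hcl⟩ | ⟨B, hB, hBc, hcl⟩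
      · exact .inl ⟨B, fun y hy => (hxmem _ B hB).2.1 (Finset.mem_insert_of_mem hy), hBc, hcl⟩
      · obtain ⟨h₁, h₂, h₃⟩ := hxmem _ B hB
        refine .inr ⟨insert x B, h₂, by rw [Finset.card_insert_of_notMem h₁]; omega, ?_⟩
        rw [← isClique_compl, Finset.coe_insert, isClique_insert, isClique_compl]
        exact ⟨hcl, fun y hy hxy => (compl_adj ..).2 ⟨hxy, h₃ y hy⟩⟩

theorem star_isIndContained {V : Type u} {G : SimpleGraph V} {w : V} {B : Finset V}
    (hB : G.IsIndepSet (B : Set V)) (hw : ∀ b ∈ B, G.Adj w b) :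
    (star B.card).IsIndContained G := by
  let e := B.equivFin.symm
  refine ⟨⟨⟨Sum.elim (fun _ => w) (fun i => e i), ?_⟩, ?_⟩⟩
  · rintro (i | i) (j | j) h
    · exact congrArg _ (Subsingleton.elim _ _)
    · exact absurd (hw _ (e j).2) (by simp only [Sum.elim_inl, Sum.elim_inr] at h; simp [← h])
    · exact absurd (hw _ (e i).2) (by simp only [Sum.elim_inl, Sum.elim_inr] at h; simp [h])
    · exact congrArg _ (e.injective (Subtype.ext h))
  · rintro (i | i) (j | j)
    · exact ⟨fun h => (G.loopless.irrefl _ h).elim, fun h => by simp at h⟩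
    · exact ⟨fun _ => by simp, fun _ => hw _ (e j).2⟩
    · exact ⟨fun _ => by simp, fun _ => (hw _ (e i).2).symm⟩
    · exact ⟨fun h => (hB (e i).2 (e j).2 h.ne h).elim, fun h => by simp at h⟩

/-- The hairs are private neighbours `b w` of the clique vertices; privacy also makes `b` injective
on `W`. -/
theorem hairyComplete_isIndContained {V : Type u} {G : SimpleGraph V} {W : Finset V}
    (hW : G.IsClique (W : Set V)) (b : V → V)
    (hb : ∀ w ∈ W, ∀ w' ∈ W, G.Adj w' (b w) ↔ w' = w)
    (hbW : ∀ w ∈ W, b w ∉ W)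
    (hind : ∀ w ∈ W, ∀ w' ∈ W, ¬ G.Adj (b w) (b w')) :
    (hairyComplete W.card).IsIndContained G := by
  let e := W.equivFin.symm
  refine ⟨⟨⟨Sum.elim (fun i => e i) (fun i => b (e i)), ?_⟩, ?_⟩⟩
  · rintro (i | i) (j | j) h
    · exact congrArg _ (e.injective (Subtype.ext h))
    · exact absurd (e i).2 (by simp only [Sum.elim_inl, Sum.elim_inr] at h; rw [h]; exact hbW _ (e j).2)
    · exact absurd (e j).2 (by simp only [Sum.elim_inl, Sum.elim_inr] at h; rw [← h]; exact hbW _ (e i).2)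
    · refine congrArg _ (e.injective (Subtype.ext ?_))
      refine (hb _ (e j).2 _ (e i).2).1 ?_
      simp only [Sum.elim_inr] at h
      rw [← h]
      exact (hb _ (e i).2 _ (e i).2).2 rfl
  · rintro (i | i) (j | j)
    · refine ⟨fun h => ?_, fun h => hW (e i).2 (e j).2 fun h' => h (e.injective (Subtype.ext h'))⟩
      rintro rfl
      exact G.loopless.irrefl _ h
    · exact (hb _ (e j).2 _ (e i).2).trans
        (Subtype.ext_iff.symm.trans e.injective.eq_iff)
    · exact (G.adj_comm _ _).trans ((hb _ (e i).2 _ (e j).2).trans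
        (Subtype.ext_iff.symm.trans (e.injective.eq_iff.trans eq_comm)))
    · exact ⟨fun h => hind _ (e i).2 _ (e j).2 h, False.elim⟩

theorem star_mono {r t : ℕ} (h : r ≤ t) : (star r).IsIndContained (star t) := by
  refine ⟨⟨⟨Sum.map id (Fin.castLE h), Sum.map_injective.2 ⟨Function.injective_id,
    Fin.castLE_injective h⟩⟩, ?_⟩⟩
  rintro (i | i) (j | j) <;> simp

/-- A set `I` dominated by a finite set has a dominating subset in which every vertex has a
private neighbour in `I`. -/
theorem exists_private_neighbours {V : Type u} {G : SimpleGraph V} {I W₀ : Finset V}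
    (h : ∀ v ∈ I, ∃ w ∈ W₀, G.Adj w v) :
    ∃ W ⊆ W₀, (∀ v ∈ I, ∃ w ∈ W, G.Adj w v) ∧
      ∀ w ∈ W, ∃ v ∈ I, ∀ w' ∈ W, G.Adj w' v ↔ w' = w := by
  classical
  induction hn : W₀.card generalizing W₀ with
  | zero =>
    obtain rfl := Finset.card_eq_zero.1 hn
    exact ⟨∅, subset_rfl, h, by simp⟩
  | succ m ih =>
    by_cases hp : ∀ w ∈ W₀, ∃ v ∈ I, ∀ w' ∈ W₀, G.Adj w' v ↔ w' = w
    · exact ⟨W₀, subset_rfl, h, hp⟩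
    · push Not at hp
      obtain ⟨w, hw, hp⟩ := hp
      -- A vertex `w` without a private neighbour is redundant: whatever it dominates has another
      -- neighbour in `W₀`.
      obtain ⟨W, hW, h₁, h₂⟩ := ih (W₀ := W₀.erase w) (fun v hv => by
        obtain ⟨w', hw', hor⟩ := hp v hv
        by_cases hww : w' = w
        · obtain ⟨u, hu, huv⟩ := h v hv
          refine ⟨u, Finset.mem_erase.2 ⟨?_, hu⟩, huv⟩
          rintro rfl
          subst hww
          rcases hor with h | h
          · exact h.2 rfl
          · exact h.1 huv
        · refine ⟨w', Finset.mem_erase.2 ⟨hww, hw'⟩, ?_⟩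
          rcases hor with h | h
          · exact h.1
          · exact absurd h.2 hww) (by rw [Finset.card_erase_of_mem hw]; omega)
      exact ⟨W, hW.trans (Finset.erase_subset _ _), h₁, h₂⟩

/-- In a connected graph without induced `K_{1,r}` and `K_s^h`, independent sets in balls of
radius `k` have bounded size. -/
theorem exists_indep_bound_ball (r s k : ℕ) : ∃ N : ℕ, ∀ {V : Type u} [Fintype V]
    {G : SimpleGraph V}, G.Connected → ¬ (star r).IsIndContained G →
    ¬ (hairyComplete s).IsIndContained G → ∀ (x : V) (I : Finset V),
    G.IsIndepSet (I : Set V) → (∀ v ∈ I, G.dist x v ≤ k) → I.card ≤ N := by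
  classical
  induction k with
  | zero =>
    refine ⟨1, fun {V} _ {G} hG _ _ x I _ hI => Finset.card_le_one.2 fun a ha b hb => ?_⟩
    have h : ∀ v ∈ I, x = v := fun v hv => hG.dist_eq_zero_iff.1 (Nat.le_zero.1 (hI v hv))
    rw [← h a ha, ← h b hb]
  | succ k ih =>
    obtain ⟨N, hN⟩ := ih
    refine ⟨N + 2 ^ (s + (N + 1)) * r, fun {V} _ {G} hG hr hs x I hI hd => ?_⟩
    have hmono : ∀ J ⊆ I, G.IsIndepSet (J : Set V) :=
      fun J hJ => Set.Pairwise.mono (Finset.coe_subset.2 hJ) hI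
    have h₁ := hN hG hr hs x (I.filter (fun v => G.dist x v ≤ k))
      (hmono _ (Finset.filter_subset _ _)) (fun v hv => (Finset.mem_filter.1 hv).2)
    have hsplit := Finset.card_filter_add_card_filter_not (s := I) (fun v => G.dist x v ≤ k)
    set I' := I.filter (fun v => ¬ G.dist x v ≤ k) with hI'
    have hI'd : ∀ v ∈ I', ¬ G.dist x v ≤ k := fun v hv => (Finset.mem_filter.1 hv).2
    have hI'i : I' ⊆ I := Finset.filter_subset _ _
    have hdom : ∀ v ∈ I', ∃ w ∈ Finset.univ.filter (fun w => G.dist x w ≤ k), G.Adj w v := by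
      intro v hv
      obtain ⟨p, hp⟩ := hG.exists_walk_length_eq_dist v x
      have hv1 := hI'd v hv
      cases p with
      | nil => simp at hv1
      | cons hadj q =>
        rename_i w
        refine ⟨w, Finset.mem_filter.2 ⟨Finset.mem_univ _, ?_⟩, hadj.symm⟩
        have := dist_le q
        rw [Walk.length_cons, dist_comm] at hp
        have := hd v (hI'i hv)
        rw [dist_comm]
        omega
    obtain ⟨W, hW, hWd, hWp⟩ := exists_private_neighbours hdom
    have hWk : ∀ w ∈ W, G.dist x w ≤ k := fun w hw => (Finset.mem_filter.1 (hW hw)).2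
    -- In a larger `W`, Ramsey gives either a clique of size `s`, which its private neighbours
    -- complete to an induced `K_s^h`, or `N + 1` independent vertices in the ball of radius `k`,
    -- against the induction hypothesis.
    have hWcard : W.card < 2 ^ (s + (N + 1)) := by
      by_contra! hcon
      rcases exists_clique_or_indep G s (N + 1) W hcon with ⟨B, hB, hBc, hcl⟩ | ⟨B, hB, hBc, hcl⟩
      · have : ∀ w, ∃ v, w ∈ W → v ∈ I' ∧ ∀ w' ∈ W, G.Adj w' v ↔ w' = w := fun w => by
          by_cases hw : w ∈ W
          · obtain ⟨v, hv⟩ := hWp w hw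
            exact ⟨v, fun _ => hv⟩
          · exact ⟨w, fun h => absurd h hw⟩
        choose b hb using this
        refine hs (hBc ▸ hairyComplete_isIndContained hcl b
          (fun w hw w' hw' => (hb w (hB hw)).2 w' (hB hw'))
          (fun w hw hw' => hI'd _ (hb w (hB hw)).1 (hWk _ (hB hw')))
          (fun w hw w' hw' hadj => ?_))
        exact hI (hI'i (hb w (hB hw)).1) (hI'i (hb w' (hB hw')).1) hadj.ne hadj
      · have := hN hG hr hs x B hcl (fun v hv => hWk v (hB hv))
        omega
    have hcover : I' ⊆ W.biUnion (fun w => I'.filter (fun v => G.Adj w v)) := by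
      intro v hv
      obtain ⟨w, hw, hadj⟩ := hWd v hv
      exact Finset.mem_biUnion.2 ⟨w, hw, Finset.mem_filter.2 ⟨hv, hadj⟩⟩
    have hdeg : ∀ w ∈ W, (I'.filter (fun v => G.Adj w v)).card ≤ r := by
      intro w _
      by_contra! hcon
      exact hr ((star_mono hcon.le).trans (star_isIndContained
        (hmono _ ((Finset.filter_subset _ _).trans hI'i))
        (fun b hb => (Finset.mem_filter.1 hb).2)))
    have h₂ : I'.card ≤ W.card * r :=
      (Finset.card_le_card hcover).trans (Finset.card_biUnion_le_card_mul _ _ _ hdeg)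
    have h₃ : W.card * r ≤ 2 ^ (s + (N + 1)) * r := Nat.mul_le_mul_right _ hWcard.le
    omega

/-- A shortest path is an induced path. -/
theorem pathGraph_isIndContained_of_dist {V : Type u} {G : SimpleGraph V} (hG : G.Connected)
    {x y : V} {l : ℕ} (h : l ≤ G.dist x y + 1) : (pathGraph l).IsIndContained G := by
  obtain ⟨p, hp⟩ := hG.exists_walk_length_eq_dist x y
  -- Every segment of a geodesic is a geodesic, so non-consecutive vertices are neither equal nor
  -- adjacent.
  have hd : ∀ i j, i ≤ j → j ≤ p.length → G.dist (p.getVert i) (p.getVert j) = j - i := by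
    intro i j hij hj
    refine le_antisymm ?_ ?_
    · have hz : (p.drop i).getVert (j - i) = p.getVert j := by
        rw [Walk.drop_getVert, show i + (j - i) = j by omega]
      rw [← hz]
      exact (dist_le ((p.drop i).take (j - i))).trans (by simp)
    · have h₁ := dist_le (p.take i)
      have h₂ := dist_le (p.drop j)
      have h₃ := hG.dist_triangle (u := x) (v := p.getVert i) (w := y)
      have h₄ := hG.dist_triangle (u := p.getVert i) (v := p.getVert j) (w := y)
      rw [Walk.take_length] at h₁
      rw [Walk.drop_length] at h₂
      omega
  refine ⟨⟨⟨fun i : Fin l => p.getVert i, fun i j hij => ?_⟩, fun {i j} => ?_⟩⟩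
  · have hij : p.getVert i = p.getVert j := hij
    rcases le_total (i : ℕ) j with hle | hle
    · have := hd i j hle (by omega)
      rw [hij, SimpleGraph.dist_self] at this
      omega
    · have := hd j i hle (by omega)
      rw [hij, SimpleGraph.dist_self] at this
      omega
  · rw [pathGraph_adj]
    change G.Adj (p.getVert i) (p.getVert j) ↔ _
    rw [← dist_eq_one_iff_adj]
    rcases le_total (i : ℕ) j with hle | hle
    · rw [hd i j hle (by omega)]
      omega
    · rw [dist_comm, hd j i hle (by omega)]
      omega

/-- A maximal independent set disjoint from a given set `X`. -/
theorem exists_maximal_indep {V : Type u} [Fintype V] (G : SimpleGraph V) (X : Finset V) :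
    ∃ I : Finset V, G.IsIndepSet (I : Set V) ∧ (∀ v ∈ I, v ∉ X) ∧
      ∀ v, v ∉ X → v ∉ I → ∃ w ∈ I, G.Adj v w := by
  classical
  obtain ⟨I, hI, hmax⟩ := Finset.exists_max_image
    (Finset.univ.filter fun I : Finset V => G.IsIndepSet (I : Set V) ∧ ∀ v ∈ I, v ∉ X)
    Finset.card ⟨∅, by simp⟩
  simp only [Finset.mem_filter, Finset.mem_univ, true_and] at hI hmax
  refine ⟨I, hI.1, hI.2, fun v hvX hvI => ?_⟩
  by_contra! hcon
  have := hmax (insert v I) ⟨?_, ?_⟩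
  · rw [Finset.card_insert_of_notMem hvI] at this
    omega
  · rw [← isClique_compl, Finset.coe_insert, isClique_insert, isClique_compl]
    exact ⟨hI.1, fun w hw hvw => (compl_adj ..).2 ⟨hvw, hcon w hw⟩⟩
  · intro w hw
    rcases Finset.mem_insert.1 hw with rfl | hw
    exacts [hvX, hI.2 w hw]

/-- The ball of radius `l` about any vertex is the whole graph, so independent sets have at most `N`
elements. Three disjoint ones give each remaining vertex three distinct neighbours in a set of size
at most `3N`, which a walk of length at most `3Nl` visits. -/
theorem exists_rainbowIndex_bound (r s l : ℕ) : ∃ N : ℕ, ∀ {V : Type u} [Fintype V]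
    {G : SimpleGraph V}, G.Connected → ¬ (star r).IsIndContained G →
    ¬ (hairyComplete s).IsIndContained G → ¬ (pathGraph l).IsIndContained G →
    rainbowIndex G 3 ≤ N := by
  classical
  obtain ⟨N, hN⟩ := exists_indep_bound_ball.{u} r s l
  refine ⟨(N + N + N) * l + 3, fun {V} _ {G} hG hr hs hl => ?_⟩
  have hdist : ∀ x y, G.dist x y ≤ l := fun x y => by
    by_contra! hcon
    exact hl (pathGraph_isIndContained_of_dist hG (x := x) (y := y) (by omega))
  obtain ⟨x⟩ := hG.nonempty
  obtain ⟨I₀, hI₀, -, hd₀⟩ := exists_maximal_indep G ∅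
  obtain ⟨I₁, hI₁, hX₁, hd₁⟩ := exists_maximal_indep G I₀
  obtain ⟨I₂, hI₂, hX₂, hd₂⟩ := exists_maximal_indep G (I₀ ∪ I₁)
  have hc₀ := hN hG hr hs x I₀ hI₀ fun v _ => hdist x v
  have hc₁ := hN hG hr hs x I₁ hI₁ fun v _ => hdist x v
  have hc₂ := hN hG hr hs x I₂ hI₂ fun v _ => hdist x v
  have hex : ∀ v, ∃ n₀ n₁ n₂, v ∉ I₀ ∪ I₁ ∪ I₂ → (n₀ ∈ I₀ ∧ G.Adj v n₀) ∧ (n₁ ∈ I₁ ∧ G.Adj v n₁) ∧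
      (n₂ ∈ I₂ ∧ G.Adj v n₂) := by
    intro v
    by_cases hv : v ∈ I₀ ∪ I₁ ∪ I₂
    · exact ⟨v, v, v, fun h => absurd hv h⟩
    · simp only [Finset.mem_union, not_or] at hv
      obtain ⟨n₀, h₀⟩ := hd₀ v (by simp) hv.1.1
      obtain ⟨n₁, h₁⟩ := hd₁ v hv.1.1 hv.1.2
      obtain ⟨n₂, h₂⟩ := hd₂ v (by simp [hv]) hv.2
      exact ⟨n₀, n₁, n₂, fun _ => ⟨h₀, h₁, h₂⟩⟩
  choose n₀ n₁ n₂ hn using hex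
  obtain ⟨y, p, hp, hlen⟩ := exists_walk_through (d := l) (fun a b => by
    obtain ⟨p, hp⟩ := hG.exists_walk_length_eq_dist a b
    exact ⟨p, hp ▸ hdist a b⟩) (I₀ ∪ I₁ ∪ I₂) x
  have hcard : (I₀ ∪ I₁ ∪ I₂).card ≤ N + N + N :=
    (Finset.card_union_le _ _).trans
      (Nat.add_le_add ((Finset.card_union_le _ _).trans (Nat.add_le_add hc₀ hc₁)) hc₂)
  have hfin := rainbowIndex_le_of_walk p hp ![n₀, n₁, n₂]
    (fun i v hv => by
      obtain ⟨h₀, h₁, h₂⟩ := hn v hv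
      fin_cases i
      exacts [h₀.2, h₁.2, h₂.2])
    (fun i v hv => by
      obtain ⟨h₀, h₁, h₂⟩ := hn v hv
      simp only [Finset.mem_union]
      fin_cases i
      exacts [.inl (.inl h₀.1), .inl (.inr h₁.1), .inr h₂.1])
    (fun i j v hv hij => by
      obtain ⟨⟨h₀, -⟩, ⟨h₁, -⟩, ⟨h₂, -⟩⟩ := hn v hv
      have h₀₁ : n₀ v ≠ n₁ v := fun h => hX₁ _ h₁ (h ▸ h₀)
      have h₀₂ : n₀ v ≠ n₂ v := fun h => hX₂ _ h₂ (Finset.mem_union_left _ (h ▸ h₀))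
      have h₁₂ : n₁ v ≠ n₂ v := fun h => hX₂ _ h₂ (Finset.mem_union_right _ (h ▸ h₁))
      fin_cases i <;> fin_cases j <;>
        first | rfl | exact absurd hij h₀₁ | exact absurd hij h₀₂ | exact absurd hij h₁₂ |
          exact absurd hij.symm h₀₁ | exact absurd hij.symm h₀₂ | exact absurd hij.symm h₁₂)
  have := Nat.mul_le_mul_right l hcard
  omega

/-! ### Lower bounds from pendant edges -/

/-- Pendant edges need pairwise distinct colours. -/
theorem le_rainbowIndex_of_pendant {V : Type u} [Finite V] {G : SimpleGraph V}
    (hG : G.Connected) {n : ℕ} (hn : 3 ≤ n) (p q : Fin n → V)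
    (hadj : ∀ i w, G.Adj (p i) w ↔ w = q i)
    (hinj : ∀ i j, s(p i, q i) = s(p j, q j) → i = j) : n ≤ rainbowIndex G 3 := by
  classical
  obtain ⟨c, hc⟩ := exists_isRainbowColoring hG 3
  have hp : ∀ i j, p i = p j → i = j := fun i j h => by
    have : q i = q j := (hadj j _).1 (h ▸ (hadj i _).2 rfl)
    exact hinj i j (by rw [h, this])
  have hedge : ∀ i, s(p i, q i) ∈ G.edgeSet := fun i => (hadj i _).2 rfl
  have hcinj : Function.Injective fun i => c ⟨s(p i, q i), hedge i⟩ := by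
    intro i j hij
    by_contra hne
    -- A third pendant vertex completes the pair to a triple. A tree through it must use the pendant
    -- edges at `p i` and `p j`, as it has no other edge there.
    obtain ⟨k, -, hk⟩ := Finset.exists_mem_notMem_of_card_lt_card
      (s := ({i, j} : Finset (Fin n))) (t := Finset.univ)
      (by rw [Finset.card_pair hne, Finset.card_univ, Fintype.card_fin]; omega)
    simp only [Finset.mem_insert, Finset.mem_singleton, not_or] at hk
    obtain ⟨T, ⟨hT, hS⟩, hrb⟩ := hc {p i, p j, p k} (Finset.card_eq_three.2
      ⟨_, _, _, fun h => hne (hp _ _ h), fun h => hk.1 (hp _ _ h).symm,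
        fun h => hk.2 (hp _ _ h).symm, rfl⟩)
    have hi : p i ∈ T.verts := hS _ (by simp)
    have hj : p j ∈ T.verts := hS _ (by simp)
    have : Nontrivial T.verts := ⟨⟨p i, hi⟩, ⟨p j, hj⟩, fun h => hne (hp _ _ (congrArg Subtype.val h))⟩
    have hmem : ∀ l, p l ∈ T.verts → s(p l, q l) ∈ T.edgeSet := by
      intro l hl
      obtain ⟨w, hw⟩ := hT.connected.preconnected.exists_adj_of_nontrivial ⟨p l, hl⟩
      have hw' : T.Adj (p l) w := hw
      rwa [(hadj l w).1 hw'.adj_sub] at hw'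
    exact hne (hinj i j (congrArg Subtype.val
      (hrb ⟨_, hedge i⟩ ⟨_, hedge j⟩ (hmem i hi) (hmem j hj) hij)))
  simpa using Fintype.card_le_of_injective _ hcinj

theorem exists_walk_of_centre {V : Type u} {G : SimpleGraph V} {d : ℕ} {x : V}
    (h : ∀ v, ∃ p : G.Walk x v, p.length ≤ d) (a b : V) :
    ∃ p : G.Walk a b, p.length ≤ d + d := by
  obtain ⟨p, hp⟩ := h a
  obtain ⟨q, hq⟩ := h b
  exact ⟨p.reverse.append q, by rw [Walk.length_append, Walk.length_reverse]; omega⟩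

theorem star_walk (n : ℕ) (v : Fin 1 ⊕ Fin n) :
    ∃ p : (star n).Walk (.inl 0) v, p.length ≤ 1 := by
  rcases v with i | i
  · obtain rfl := Subsingleton.elim i 0
    exact ⟨.nil, by simp⟩
  · exact ⟨.cons (by simp) .nil, by simp⟩

theorem hairyComplete_walk {n : ℕ} (x : Fin n) (v : Fin n ⊕ Fin n) :
    ∃ p : (hairyComplete n).Walk (.inl x) v, p.length ≤ 2 := by
  have h₁ : ∀ i, ∃ p : (hairyComplete n).Walk (.inl x) (.inl i), p.length ≤ 1 := by
    intro i
    by_cases h : x = i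
    · subst h
      exact ⟨.nil, by simp⟩
    · exact ⟨.cons (show (hairyComplete n).Adj (.inl x) (.inl i) from h) .nil, by simp⟩
  rcases v with i | i
  · obtain ⟨p, hp⟩ := h₁ i
    exact ⟨p, by omega⟩
  · obtain ⟨p, hp⟩ := h₁ i
    refine ⟨p.concat (show (hairyComplete n).Adj (.inl i) (.inr i) from rfl), ?_⟩
    rw [Walk.length_concat]
    omega

theorem connected_of_walk {V : Type u} {G : SimpleGraph V} {d : ℕ} {x : V}
    (h : ∀ v, ∃ p : G.Walk x v, p.length ≤ d) : G.Connected :=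
  connected_iff_exists_forall_reachable _ |>.2 ⟨x, fun v => (h v).choose.reachable⟩

theorem le_rainbowIndex_star {n : ℕ} (hn : 3 ≤ n) : n ≤ rainbowIndex (star n) 3 := by
  refine le_rainbowIndex_of_pendant (connected_of_walk (star_walk n)) hn (fun i => .inr i)
    (fun _ => .inl 0) ?_ ?_
  · rintro i (j | j)
    · simp [Subsingleton.elim j 0]
    · simp
  · intro i j h
    simpa using h

theorem le_rainbowIndex_hairyComplete {n : ℕ} (hn : 3 ≤ n) :
    n ≤ rainbowIndex (hairyComplete n) 3 := by
  refine le_rainbowIndex_of_pendant (connected_of_walk (hairyComplete_walk ⟨0, by omega⟩)) hn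
    (fun i => .inr i) (fun i => .inl i) ?_ ?_
  · rintro i (j | j)
    · exact ⟨fun h => congrArg _ (Eq.symm h), fun h => (Sum.inl.inj h).symm⟩
    · exact ⟨False.elim, fun h => (Sum.inr_ne_inl h).elim⟩
  · intro i j h
    simpa using h

/-! ### Steiner diameter and rainbow index of cycles -/

/-- A predicate respected by adjacency is constant on a connected graph. -/
theorem iff_of_connected {V : Type u} {G : SimpleGraph V} (hG : G.Connected) {P : V → Prop}
    (h : ∀ a b, G.Adj a b → (P a ↔ P b)) (a b : V) : P a ↔ P b := by
  obtain ⟨p⟩ := hG.preconnected a b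
  induction p with
  | nil => rfl
  | cons hadj _ ih => exact (h _ _ hadj).trans ih

/-- The cycle on `n` vertices. -/
def cycle (n : ℕ) : SimpleGraph (Fin n) where
  Adj u v := u ≠ v ∧ ((u : ℕ) + 1 = v ∨ (v : ℕ) + 1 = u ∨ ((u : ℕ) + 1 = n ∧ (v : ℕ) = 0) ∨
    ((v : ℕ) + 1 = n ∧ (u : ℕ) = 0))
  symm := ⟨fun _ _ h => ⟨h.1.symm, by tauto⟩⟩
  loopless := ⟨fun _ h => h.1 rfl⟩

/-- The vertex of the cycle that represents the residue of `i`. -/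
def cycleVert (n : ℕ) [NeZero n] (i : ℕ) : Fin n := Fin.ofNat n i

theorem cycleVert_val (n : ℕ) [NeZero n] (i : ℕ) : (cycleVert n i : ℕ) = i % n := rfl

theorem cycleVert_succ_val (n : ℕ) [NeZero n] (i : ℕ) :
    (cycleVert n (i + 1) : ℕ) = if i % n + 1 = n then 0 else i % n + 1 := by
  rw [cycleVert_val, ← Nat.mod_add_mod]
  have := Nat.mod_lt i (NeZero.pos n)
  split_ifs with h
  · rw [h, Nat.mod_self]
  · exact Nat.mod_eq_of_lt (by omega)

theorem cycleVert_of_fin {n : ℕ} [NeZero n] (i : Fin n) : cycleVert n i = i :=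
  Fin.ext (Nat.mod_eq_of_lt i.2)

theorem cycle_adj_cycleVert {n : ℕ} [NeZero n] (hn : 2 ≤ n) (i : ℕ) :
    (cycle n).Adj (cycleVert n i) (cycleVert n (i + 1)) := by
  have h₁ := cycleVert_val n i
  have h₂ := cycleVert_succ_val n i
  refine ⟨fun h => ?_, ?_⟩
  · rw [h, h₂] at h₁
    split_ifs at h₁ <;> omega
  · rw [h₁, h₂]
    split_ifs <;> omega

theorem cycle_exists_walk {n : ℕ} [NeZero n] (hn : 2 ≤ n) (a k : ℕ) :
    ∃ p : (cycle n).Walk (cycleVert n a) (cycleVert n (a + k)),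
      p.length = k ∧ ∀ i ≤ k, cycleVert n (a + i) ∈ p.support := by
  induction k with
  | zero => exact ⟨.nil, rfl, fun i hi => by obtain rfl := Nat.le_zero.1 hi; simp⟩
  | succ k ih =>
    obtain ⟨p, hp, hs⟩ := ih
    refine ⟨p.concat (cycle_adj_cycleVert hn (a + k)), by rw [Walk.length_concat, hp], ?_⟩
    intro i hi
    rw [Walk.support_concat, List.mem_append]
    rcases Nat.lt_or_ge k i with h | h
    · obtain rfl : i = k + 1 := by omega
      exact .inr (by simp)
    · exact .inl (hs i h)

theorem cycle_connected {n : ℕ} [NeZero n] (hn : 2 ≤ n) : (cycle n).Connected := by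
  refine (connected_iff_exists_forall_reachable _).2 ⟨cycleVert n 0, fun v => ?_⟩
  obtain ⟨p, -⟩ := cycle_exists_walk hn 0 v
  rw [Nat.zero_add, cycleVert_of_fin] at p
  exact p.reachable

/-- Three vertices cut the cycle into three arcs of total length `3m`. One arc has length at least
`m`, and its complement is a path through all three vertices. -/
theorem steinerDiam_cycle_le {m : ℕ} [NeZero (3 * m)] (hm : 1 ≤ m) :
    steinerDiam (cycle (3 * m)) 3 ≤ 2 * m := by
  refine steinerDiam_le fun S hS => ?_
  obtain ⟨x, y, z, hxy, hxz, hyz, rfl⟩ := Finset.card_eq_three.1 hS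
  have key : ∃ a : ℕ, ∀ s ∈ ({x, y, z} : Finset (Fin (3 * m))),
      ∃ i ≤ 2 * m, a + i = s ∨ a + i = s + 3 * m := by
    suffices ∃ a : ℕ, (∃ i ≤ 2 * m, a + i = x ∨ a + i = x + 3 * m) ∧
        (∃ i ≤ 2 * m, a + i = y ∨ a + i = y + 3 * m) ∧
        (∃ i ≤ 2 * m, a + i = z ∨ a + i = z + 3 * m) by simpa using this
    have hi : ∀ a s : ℕ, ((a ≤ s ∧ s ≤ a + 2 * m) ∨ (a ≤ s + 3 * m ∧ s + m ≤ a)) →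
        ∃ i ≤ 2 * m, a + i = s ∨ a + i = s + 3 * m := by
      rintro a s (h | h)
      · exact ⟨s - a, by omega, .inl (by omega)⟩
      · exact ⟨s + 3 * m - a, by omega, .inr (by omega)⟩
    have hx := x.2
    have hy := y.2
    have hz := z.2
    -- One of the three vertices reaches both others within `2m` forward steps; the second
    -- alternative for each target is the case of passing through `0`.
    have hcases : (((x : ℕ) ≤ y ∧ (y : ℕ) ≤ x + 2 * m ∨ (y : ℕ) + m ≤ x) ∧
          ((x : ℕ) ≤ z ∧ (z : ℕ) ≤ x + 2 * m ∨ (z : ℕ) + m ≤ x)) ∨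
        (((y : ℕ) ≤ x ∧ (x : ℕ) ≤ y + 2 * m ∨ (x : ℕ) + m ≤ y) ∧
          ((y : ℕ) ≤ z ∧ (z : ℕ) ≤ y + 2 * m ∨ (z : ℕ) + m ≤ y)) ∨
        (((z : ℕ) ≤ x ∧ (x : ℕ) ≤ z + 2 * m ∨ (x : ℕ) + m ≤ z) ∧
          ((z : ℕ) ≤ y ∧ (y : ℕ) ≤ z + 2 * m ∨ (y : ℕ) + m ≤ z)) := by
      omega
    rcases hcases with h | h | h
    · exact ⟨x, hi _ _ (by omega), hi _ _ (by omega), hi _ _ (by omega)⟩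
    · exact ⟨y, hi _ _ (by omega), hi _ _ (by omega), hi _ _ (by omega)⟩
    · exact ⟨z, hi _ _ (by omega), hi _ _ (by omega), hi _ _ (by omega)⟩
  obtain ⟨a, ha⟩ := key
  obtain ⟨p, hp, hs⟩ := cycle_exists_walk (n := 3 * m) (by omega) a (2 * m)
  refine (steinerDist_le_length p fun s hsS => ?_).trans hp.le
  obtain ⟨i, hi, h⟩ := ha s hsS
  have : cycleVert (3 * m) (a + i) = s := by
    apply Fin.ext
    rw [cycleVert_val]
    rcases h with h | h
    · rw [h, Nat.mod_eq_of_lt s.2]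
    · rw [h, Nat.add_mod_right, Nat.mod_eq_of_lt s.2]
  exact this ▸ hs i hi

/-- Two edges missing from a connected subgraph of a cycle separate the cycle. -/
theorem cycle_separation {n : ℕ} [NeZero n] {T : (cycle n).Subgraph} (hT : T.coe.Connected)
    {p q : ℕ} (hp : p < n) (hq : q < n)
    (hp' : ¬ T.Adj (cycleVert n p) (cycleVert n (p + 1)))
    (hq' : ¬ T.Adj (cycleVert n q) (cycleVert n (q + 1))) {x y : Fin n}
    (hx : x ∈ T.verts) (hy : y ∈ T.verts) :
    ((p < x ∧ x ≤ q) ∨ (q < (x : ℕ) ∧ x ≤ p)) ↔ ((p < y ∧ y ≤ q) ∨ (q < (y : ℕ) ∧ y ≤ p)) := by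
  have key : ∀ r < n, ¬ T.Adj (cycleVert n r) (cycleVert n (r + 1)) → ∀ a b : Fin n,
      T.Adj a b → ((a : ℕ) = r → ¬ ((a : ℕ) + 1 = b ∨ ((a : ℕ) + 1 = n ∧ (b : ℕ) = 0))) := by
    intro r hr h a b hab har hor
    refine h ?_
    have ha : cycleVert n r = a := by rw [← har, cycleVert_of_fin]
    have hb : cycleVert n (r + 1) = b := by
      apply Fin.ext
      rw [cycleVert_succ_val, Nat.mod_eq_of_lt hr]
      split_ifs <;> omega
    rwa [ha, hb]
  -- Membership in the arc between the two missing edges changes only across those edges.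
  refine iff_of_connected hT (P := fun v : T.verts =>
    (p < (v : Fin n) ∧ (v : Fin n) ≤ q) ∨ (q < ((v : Fin n) : ℕ) ∧ (v : Fin n) ≤ p)) ?_
    ⟨x, hx⟩ ⟨y, hy⟩
  rintro ⟨a, ha⟩ ⟨b, hb⟩ hab
  have hab : T.Adj a b := hab
  have h₁ := key p hp hp' a b hab
  have h₂ := key p hp hp' b a hab.symm
  have h₃ := key q hq hq' a b hab
  have h₄ := key q hq hq' b a hab.symm
  have h₅ := hab.adj_sub.2
  have := a.2
  have := b.2
  dsimp only
  omega

/-- With at most `n - 3` colours, three edges repeat the colour of an earlier edge. These three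
monochromatic pairs must cross pairwise, and three pairwise crossing pairs already block some triple
of vertices. -/
theorem le_rainbowIndex_cycle {n : ℕ} [NeZero n] (hn : 3 ≤ n) :
    n ≤ rainbowIndex (cycle n) 3 + 2 := by
  classical
  obtain ⟨c, hc⟩ := exists_isRainbowColoring (cycle_connected (n := n) (by omega)) 3
  by_contra! hlt
  let ed : ℕ → (cycle n).edgeSet := fun i =>
    ⟨s(cycleVert n i, cycleVert n (i + 1)), cycle_adj_cycleVert (by omega) i⟩
  let cc : ℕ → Fin (rainbowIndex (cycle n) 3) := fun i => c (ed i)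
  have hed : ∀ e f, e < n → f < n → ed e = ed f → e = f := by
    intro e f he hf h
    have h := congrArg Subtype.val h
    simp only [ed, Sym2.eq_iff, Fin.ext_iff, cycleVert_succ_val, cycleVert_val,
      Nat.mod_eq_of_lt he, Nat.mod_eq_of_lt hf] at h
    split_ifs at h <;> omega
  -- the three complementary arcs of a triple cannot all contain a repeated colour
  have bad : ∀ x y z e₁ f₁ e₂ f₂ e₃ f₃ : ℕ, x < y → y < z → z < n →
      cc e₁ = cc f₁ → cc e₂ = cc f₂ → cc e₃ = cc f₃ → e₁ ≠ f₁ → e₂ ≠ f₂ → e₃ ≠ f₃ →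
      x ≤ e₁ → e₁ < z → x ≤ f₁ → f₁ < z → e₂ < n → f₂ < n → e₃ < n → f₃ < n →
      (e₂ < x ∨ y ≤ e₂) → (f₂ < x ∨ y ≤ f₂) → (e₃ < y ∨ z ≤ e₃) → (f₃ < y ∨ z ≤ f₃) →
      -- A rainbow tree misses an edge from each of the three pairs. No single arc between `x`, `y`,
      -- `z` can contain all three missing edges, so two of them separate the triple.
      False := by
    intro x y z e₁ f₁ e₂ f₂ e₃ f₃ hxy hyz hz hc₁ hc₂ hc₃ h₁ h₂ h₃ hx₁ hz₁ hx₁' hz₁' hn₂ hn₂' hn₃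
      hn₃' ha₂ hb₂ ha₃ hb₃
    have hv : ∀ i < n, (cycleVert n i : ℕ) = i := fun i hi => Nat.mod_eq_of_lt hi
    have hvne : ∀ i j, i < n → j < n → i ≠ j → cycleVert n i ≠ cycleVert n j := by
      intro i j hi hj hij h
      rw [Fin.ext_iff, hv i hi, hv j hj] at h
      exact hij h
    obtain ⟨T, ⟨hT, hS⟩, hrb⟩ := hc {cycleVert n x, cycleVert n y, cycleVert n z}
      (Finset.card_eq_three.2 ⟨_, _, _, hvne _ _ (by omega) (by omega) (by omega),
        hvne _ _ (by omega) (by omega) (by omega), hvne _ _ (by omega) (by omega) (by omega), rfl⟩)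
    have hmiss : ∀ e f, e < n → f < n → e ≠ f → cc e = cc f →
        ∃ p, (p = e ∨ p = f) ∧ p < n ∧ ¬ T.Adj (cycleVert n p) (cycleVert n (p + 1)) := by
      intro e f he hf hne hcol
      by_contra! hcon
      exact hne (hed e f he hf (hrb (ed e) (ed f) (hcon e (.inl rfl) he) (hcon f (.inr rfl) hf) hcol))
    obtain ⟨p₁, hp₁, hp₁n, hm₁⟩ := hmiss e₁ f₁ (by omega) (by omega) h₁ hc₁
    obtain ⟨p₂, hp₂, hp₂n, hm₂⟩ := hmiss e₂ f₂ hn₂ hn₂' h₂ hc₂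
    obtain ⟨p₃, hp₃, hp₃n, hm₃⟩ := hmiss e₃ f₃ hn₃ hn₃' h₃ hc₃
    have hx : cycleVert n x ∈ T.verts := hS _ (by simp)
    have hy : cycleVert n y ∈ T.verts := hS _ (by simp)
    have hz' : cycleVert n z ∈ T.verts := hS _ (by simp)
    have s₁ := cycle_separation hT.connected hp₁n hp₂n hm₁ hm₂ hx hy
    have s₂ := cycle_separation hT.connected hp₁n hp₂n hm₁ hm₂ hy hz'
    have s₃ := cycle_separation hT.connected hp₁n hp₃n hm₁ hm₃ hx hy
    have s₄ := cycle_separation hT.connected hp₁n hp₃n hm₁ hm₃ hy hz'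
    have s₅ := cycle_separation hT.connected hp₂n hp₃n hm₂ hm₃ hx hy
    have s₆ := cycle_separation hT.connected hp₂n hp₃n hm₂ hm₃ hy hz'
    rw [hv x (by omega), hv y (by omega)] at s₁ s₃ s₅
    rw [hv y (by omega), hv z (by omega)] at s₂ s₄ s₆
    have a₁ : x ≤ p₁ ∧ p₁ < z := by rcases hp₁ with rfl | rfl <;> omega
    have a₂ : p₂ < x ∨ y ≤ p₂ := by rcases hp₂ with rfl | rfl <;> omega
    have a₃ : p₃ < y ∨ z ≤ p₃ := by rcases hp₃ with rfl | rfl <;> omega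
    clear hp₁ hp₂ hp₃ ha₂ hb₂ ha₃ hb₃
    omega
  have cross : ∀ e f e' f', e < f → e' < f' → f < f' → f' < n → cc e = cc f → cc e' = cc f' →
      e < e' ∧ e' < f := by
    intro e f e' f' h h' hff hn' hcol hcol'
    by_contra hcon
    rcases lt_trichotomy e e' with hee | rfl | hee
    · rcases Nat.lt_or_ge f e' with hfe | hfe
      · exact bad e (f + 1) f' e f e' f' e f (by omega) (by omega) (by omega) hcol hcol' hcol
          (by omega) (by omega) (by omega) (by omega) (by omega) (by omega) (by omega) (by omega)
          (by omega) (by omega) (by omega) (by omega) (by omega) (by omega) (by omega)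
      · obtain rfl : e' = f := by omega
        exact bad e e' f' e e' e' f' e f' (by omega) (by omega) (by omega) hcol hcol'
          (hcol.trans hcol')
          (by omega) (by omega) (by omega) (by omega) (by omega) (by omega) (by omega) (by omega)
          (by omega) (by omega) (by omega) (by omega) (by omega) (by omega) (by omega)
    · exact bad e f f' e f f f' e f' (by omega) (by omega) (by omega) hcol
        (hcol.symm.trans hcol') hcol'
        (by omega) (by omega) (by omega) (by omega) (by omega) (by omega) (by omega) (by omega)
        (by omega) (by omega) (by omega) (by omega) (by omega) (by omega) (by omega)
    · exact bad e' e (f + 1) e f e f e' f' (by omega) (by omega) (by omega) hcol hcol hcol'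
        (by omega) (by omega) (by omega) (by omega) (by omega) (by omega) (by omega) (by omega)
        (by omega) (by omega) (by omega) (by omega) (by omega) (by omega) (by omega)
  -- Edges outside `R` are first occurrences of their colours, hence no more numerous than the
  -- colours; so `R` has at least three elements.
  set R := (Finset.range n).filter fun f => ∃ e < f, cc e = cc f with hR
  have hcompl : ((Finset.range n).filter fun f => ¬ ∃ e < f, cc e = cc f).card ≤
      rainbowIndex (cycle n) 3 := by
    have hinj : Set.InjOn cc
        (((Finset.range n).filter fun f => ¬ ∃ e < f, cc e = cc f : Finset ℕ) : Set ℕ) := by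
      intro a ha b hb hab
      have ha := (Finset.mem_filter.1 (Finset.mem_coe.1 ha)).2
      have hb := (Finset.mem_filter.1 (Finset.mem_coe.1 hb)).2
      rcases lt_trichotomy a b with h | h | h
      · exact absurd ⟨a, h, hab⟩ hb
      · exact h
      · exact absurd ⟨b, h, hab.symm⟩ ha
    have := Finset.card_le_card_of_injOn cc (fun _ _ => Finset.mem_univ _) hinj
    simpa using this
  have hsplit := Finset.card_filter_add_card_filter_not (s := Finset.range n)
    (fun f => ∃ e < f, cc e = cc f)
  rw [Finset.card_range] at hsplit
  obtain ⟨R', hR', hcard⟩ := Finset.exists_subset_card_eq (s := R) (n := 3) (by rw [hR]; omega)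
  let g := R'.orderEmbOfFin hcard
  have hg : ∀ i, g i < n ∧ ∃ e < g i, cc e = cc (g i) := fun i => by
    have := Finset.mem_filter.1 (hR' (R'.orderEmbOfFin_mem hcard i))
    exact ⟨Finset.mem_range.1 this.1, this.2⟩
  obtain ⟨hn₀, e₀, he₀, hc₀⟩ := hg 0
  obtain ⟨hn₁, e₁, he₁, hc₁⟩ := hg 1
  obtain ⟨hn₂, e₂, he₂, hc₂⟩ := hg 2
  have h₀₁ : g 0 < g 1 := g.strictMono (by decide)
  have h₁₂ : g 1 < g 2 := g.strictMono (by decide)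
  have c₀₁ := cross _ _ _ _ he₀ he₁ h₀₁ hn₁ hc₀ hc₁
  have c₁₂ := cross _ _ _ _ he₁ he₂ h₁₂ hn₂ hc₁ hc₂
  have c₀₂ := cross _ _ _ _ he₀ he₂ (h₀₁.trans h₁₂) hn₂ hc₀ hc₂
  -- Crossing gives the order `e₀ < e₁ < e₂ < g 0 < g 1 < g 2`.
  exact bad e₀ e₂ (g 1) e₀ (g 0) e₂ (g 2) e₁ (g 1) (by omega) (by omega) (by omega) hc₀ hc₂ hc₁
    (by omega) (by omega) (by omega) (by omega) (by omega) (by omega) (by omega) (by omega)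
    (by omega) (by omega) (by omega) (by omega) (by omega) (by omega) (by omega)

/-! ### Connected induced subgraphs of cycles and stars -/

/-- A connected graph whose vertices are labelled injectively by natural numbers so that
adjacency means that the labels are consecutive is a path. -/
theorem nonempty_iso_pathGraph {V : Type u} [Fintype V] {H : SimpleGraph V} (hH : H.Connected)
    (g : V → ℕ) (hg : Function.Injective g)
    (hadj : ∀ a b, H.Adj a b ↔ g a + 1 = g b ∨ g b + 1 = g a) :
    Nonempty (H ≃g pathGraph (Fintype.card V)) := by
  classical
  have hne := hH.nonempty
  obtain ⟨a, -, ha⟩ := Finset.exists_min_image Finset.univ g Finset.univ_nonempty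
  obtain ⟨b, -, hb⟩ := Finset.exists_max_image Finset.univ g Finset.univ_nonempty
  -- A label missing between the extremes would disconnect the graph.
  have himage : Finset.univ.image g = Finset.Icc (g a) (g b) := by
    ext k
    simp only [Finset.mem_image, Finset.mem_univ, true_and, Finset.mem_Icc]
    constructor
    · rintro ⟨v, rfl⟩
      exact ⟨ha v (Finset.mem_univ _), hb v (Finset.mem_univ _)⟩
    · rintro ⟨hak, hkb⟩
      by_contra! hk
      have := iff_of_connected hH (P := fun v => g v < k) (fun u v huv => by
        have := hk u
        have := hk v
        have := (hadj u v).1 huv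
        omega) a b
      have := hk a
      omega
  have hcard := congrArg Finset.card himage
  rw [Finset.card_image_of_injective _ hg, Finset.card_univ, Nat.card_Icc] at hcard
  have hlt : ∀ v, g v - g a < Fintype.card V := fun v => by
    have := ha v (Finset.mem_univ _)
    have := hb v (Finset.mem_univ _)
    omega
  let e : V → Fin (Fintype.card V) := fun v => ⟨g v - g a, hlt v⟩
  have he : Function.Injective e := fun u v h => hg (by
    have h : g u - g a = g v - g a := congrArg Fin.val h
    have := ha v (Finset.mem_univ _)
    have := ha u (Finset.mem_univ _)
    omega)
  have hbij : Function.Bijective e :=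
    (Fintype.bijective_iff_injective_and_card e).2 ⟨he, by simp⟩
  refine ⟨⟨Equiv.ofBijective e hbij, fun {u v} => ?_⟩⟩
  rw [pathGraph_adj, hadj]
  change g u - g a + 1 = g v - g a ∨ g v - g a + 1 = g u - g a ↔ _
  have := ha v (Finset.mem_univ _)
  have := ha u (Finset.mem_univ _)
  omega

/-- A connected proper induced subgraph of a cycle is a path. -/
theorem nonempty_iso_pathGraph_of_cycle {V : Type u} [Fintype V] {H : SimpleGraph V}
    (hH : H.Connected) {n : ℕ} (hn : Fintype.card V < n) (h : H.IsIndContained (cycle n)) :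
    Nonempty (H ≃g pathGraph (Fintype.card V)) := by
  obtain ⟨f⟩ := h
  obtain ⟨m, hm⟩ : ∃ m, ∀ v, f v ≠ m := by
    by_contra! hcon
    have := Fintype.card_le_of_surjective f hcon
    rw [Fintype.card_fin] at this
    omega
  have hm' : ∀ v, (f v : ℕ) ≠ m := fun v h => hm v (Fin.ext h)
  -- Cutting the cycle at the unused vertex `m` and counting forward from it gives linear labels.
  refine nonempty_iso_pathGraph hH
    (fun v => if (m : ℕ) < f v then (f v : ℕ) - m else f v + n - m) ?_ ?_
  · intro u v huv
    refine f.injective (Fin.ext ?_)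
    have := hm' u
    have := hm' v
    have := (f u).2
    have := (f v).2
    dsimp only at huv
    split_ifs at huv <;> omega
  · intro u v
    rw [← f.map_adj_iff]
    have := hm' u
    have := hm' v
    have := (f u).2
    have := (f v).2
    have := m.2
    have hne : f u ≠ f v ↔ (f u : ℕ) ≠ f v := by rw [Ne, Fin.ext_iff]
    change (f u ≠ f v ∧ _) ↔ _
    rw [hne]
    split_ifs <;> omega

/-- A connected induced subgraph of a star with at least two vertices is a star. -/
theorem nonempty_iso_star {V : Type u} [Fintype V] {H : SimpleGraph V} (hH : H.Connected)
    (hcard : 2 ≤ Fintype.card V) {n : ℕ} (h : H.IsIndContained (star n)) :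
    Nonempty (H ≃g star (Fintype.card V - 1)) := by
  classical
  obtain ⟨f⟩ := h
  have : Nontrivial V := Fintype.one_lt_card_iff_nontrivial.1 hcard
  obtain ⟨c, hc⟩ : ∃ c, f c = .inl 0 := by
    obtain ⟨v⟩ := hH.nonempty
    obtain ⟨w, hvw⟩ := hH.preconnected.exists_adj_of_nontrivial v
    have hvw := f.map_adj_iff.2 hvw
    rcases hv : f v with i | i
    · exact ⟨v, by rw [hv, Subsingleton.elim i 0]⟩
    · rcases hw : f w with j | j
      · exact ⟨w, by rw [hw, Subsingleton.elim j 0]⟩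
      · simp [hv, hw] at hvw
  have hleaf : ∀ v, v ≠ c → ∃ i, f v = .inr i := by
    intro v hv
    rcases hfv : f v with i | i
    · exact absurd (f.injective (by rw [hfv, hc, Subsingleton.elim i 0])) hv
    · exact ⟨i, rfl⟩
  have e₀ : V ≃ Fin 1 ⊕ Fin (Fintype.card V - 1) :=
    Fintype.equivOfCardEq (by simp only [Fintype.card_sum, Fintype.card_fin]; omega)
  -- An arbitrary bijection, corrected to send the centre to the centre, suffices because the leaves
  -- are interchangeable.
  let e := e₀.trans (Equiv.swap (e₀ c) (.inl 0))
  have hec : e c = .inl 0 := by simp [e]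
  have heleaf : ∀ v, v ≠ c → ∃ i, e v = .inr i := by
    intro v hv
    rcases hev : e v with i | i
    · exact absurd (e.injective (by rw [hev, hec, Subsingleton.elim i 0])) hv
    · exact ⟨i, rfl⟩
  refine ⟨⟨e, fun {u v} => ?_⟩⟩
  rw [← f.map_adj_iff]
  by_cases hu : u = c <;> by_cases hv : v = c
  · subst hu; subst hv; simp
  · obtain ⟨i, hi⟩ := hleaf v hv
    obtain ⟨j, hj⟩ := heleaf v hv
    simp [hu, hc, hec, hi, hj]
  · obtain ⟨i, hi⟩ := hleaf u hu
    obtain ⟨j, hj⟩ := heleaf u hu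
    simp [hv, hc, hec, hi, hj]
  · obtain ⟨i, hi⟩ := hleaf u hu
    obtain ⟨j, hj⟩ := heleaf u hu
    obtain ⟨i', hi'⟩ := hleaf v hv
    obtain ⟨j', hj'⟩ := heleaf v hv
    simp [hi, hj, hi', hj']

/-! ### Telling the three kinds of graph apart -/

theorem nonempty_star_two_iso : Nonempty (star 2 ≃g pathGraph 3) := by
  refine ⟨⟨finSumFinEquiv.trans (Equiv.swap 0 1), fun {u v} => ?_⟩⟩
  rw [pathGraph_adj]
  rcases u with u | u <;> rcases v with v | v <;> fin_cases u <;> fin_cases v <;>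
    simp <;> decide

/-- Of three independent leaves at most one lies in the clique, so two are hairs; but distinct hairs
have no common neighbour. -/
theorem not_star_three_isIndContained_hairyComplete (s : ℕ) :
    ¬ (star 3).IsIndContained (hairyComplete s) := by
  rintro ⟨f⟩
  have hadj : ∀ i, (hairyComplete s).Adj (f (.inl 0)) (f (.inr i)) :=
    fun i => f.map_adj_iff.2 (by simp)
  have hnadj : ∀ i j, ¬ (hairyComplete s).Adj (f (.inr i)) (f (.inr j)) :=
    fun i j h => by simpa using f.map_adj_iff.1 h
  have hinj : ∀ i j, f (.inr i) = f (.inr j) → i = j :=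
    fun i j h => Sum.inr.inj (f.injective h)
  have hclique : ∀ i j, i ≠ j → ∀ a b, f (.inr i) = .inl a → f (.inr j) ≠ .inl b := by
    intro i j hij a b ha hb
    have h := hnadj i j
    rw [ha, hb] at h
    have h : ¬ a ≠ b := h
    exact hij (hinj i j (by rw [ha, hb, not_not.1 h]))
  have hhair : ∀ i j, i ≠ j → ∀ a b, f (.inr i) = .inr a → f (.inr j) ≠ .inr b := by
    intro i j hij a b ha hb
    have h₁ := hadj i
    have h₂ := hadj j
    rw [ha] at h₁
    rw [hb] at h₂
    rcases h₀ : f (.inl 0) with c | c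
    · rw [h₀] at h₁ h₂
      have h₁ : c = a := h₁
      have h₂ : c = b := h₂
      exact hij (hinj i j (by rw [ha, hb, ← h₁, ← h₂]))
    · rw [h₀] at h₁
      exact h₁
  rcases h₀ : f (.inr 0) with a | a <;> rcases h₁ : f (.inr 1) with b | b <;>
    rcases h₂ : f (.inr 2) with c | c
  exacts [hclique 0 1 (by decide) a b h₀ h₁, hclique 0 1 (by decide) a b h₀ h₁,
    hclique 0 2 (by decide) a c h₀ h₂, hhair 1 2 (by decide) b c h₁ h₂,
    hclique 1 2 (by decide) b c h₁ h₂, hhair 0 2 (by decide) a c h₀ h₂,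
    hhair 0 1 (by decide) a b h₀ h₁, hhair 0 1 (by decide) a b h₀ h₁]

theorem not_star_three_isIndContained_pathGraph (l : ℕ) :
    ¬ (star 3).IsIndContained (pathGraph l) := by
  rintro ⟨f⟩
  have hadj : ∀ i, (f (.inl 0) : ℕ) + 1 = f (.inr i) ∨ (f (.inr i) : ℕ) + 1 = f (.inl 0) :=
    fun i => pathGraph_adj.1 (f.map_adj_iff.2 (by simp))
  have hinj : ∀ i j, i ≠ j → (f (.inr i) : ℕ) ≠ f (.inr j) :=
    fun i j hij h => hij (Sum.inr.inj (f.injective (Fin.ext h)))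
  have := hadj 0
  have := hadj 1
  have := hadj 2
  have := hinj 0 1 (by decide)
  have := hinj 0 2 (by decide)
  have := hinj 1 2 (by decide)
  omega

/-- Inner path vertices have two neighbours, so they are not hairs. For `5 ≤ l` the vertices `1` and
`3` are both inner, hence adjacent in the clique, though not in the path. -/
theorem not_pathGraph_isIndContained_hairyComplete {l : ℕ} (hl : 5 ≤ l) (s : ℕ) :
    ¬ (pathGraph l).IsIndContained (hairyComplete s) := by
  rintro ⟨f⟩
  have hclique : ∀ i, 0 < i → (h : i + 1 < l) → ∃ a, f ⟨i, by omega⟩ = .inl a := by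
    intro i hi h
    have h₁ := f.map_adj_iff.2 (pathGraph_adj.2 (.inl rfl) :
      (pathGraph l).Adj ⟨i, by omega⟩ ⟨i + 1, h⟩)
    have h₂ := f.map_adj_iff.2 (pathGraph_adj.2 (.inr (show i - 1 + 1 = i by omega)) :
      (pathGraph l).Adj ⟨i, by omega⟩ ⟨i - 1, by omega⟩)
    rcases h₀ : f ⟨i, by omega⟩ with a | a
    · exact ⟨a, rfl⟩
    · rw [h₀] at h₁ h₂
      rcases h₃ : f ⟨i + 1, h⟩ with b | b
      · rcases h₄ : f ⟨i - 1, by omega⟩ with c | c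
        · rw [h₃] at h₁
          rw [h₄] at h₂
          have h₁ : a = b := h₁
          have h₂ : a = c := h₂
          have := f.injective (h₃.trans ((h₁ ▸ h₂ ▸ rfl : Sum.inl b = Sum.inl c).trans h₄.symm))
          rw [Fin.mk.injEq] at this
          omega
        · rw [h₄] at h₂
          exact h₂.elim
      · rw [h₃] at h₁
        exact h₁.elim
  obtain ⟨a, ha⟩ := hclique 1 (by omega) (by omega)
  obtain ⟨b, hb⟩ := hclique 3 (by omega) (by omega)
  have hne : a ≠ b := by
    rintro rfl
    have := f.injective (ha.trans hb.symm)
    rw [Fin.mk.injEq] at this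
    omega
  have h : (hairyComplete s).Adj (f ⟨1, by omega⟩) (f ⟨3, by omega⟩) := by
    rw [ha, hb]
    exact hne
  have := pathGraph_adj.1 (f.map_adj_iff.1 h)
  dsimp only at this
  omega

/-! ### The characterisation -/

theorem HasRainbowBound.exists_isIndContained {ι : Type} {V : ι → Type u}
    {F : ∀ i, SimpleGraph (V i)} {C : ℕ}
    (hC : ∀ (W : Type) [Fintype W] (G : SimpleGraph W),
      3 ≤ Fintype.card W → G.Connected → IsFree F G →
        rainbowIndex G 3 ≤ steinerDiam G 3 + C)
    {W : Type} [Fintype W] {G : SimpleGraph W} (hcard : 3 ≤ Fintype.card W)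
    (hG : G.Connected) (hlt : steinerDiam G 3 + C < rainbowIndex G 3) :
    ∃ i, (F i).IsIndContained G := by
  by_contra! hcon
  exact absurd (hC W G hcard hG hcon) (by omega)

end RainbowIndex

theorem theorem8 {V : Fin 3 → Type*} [∀ i, Fintype (V i)] (F : ∀ i, SimpleGraph (V i))
    (hconn : ∀ i, (F i).Connected)
    (hcard : ∀ i, 3 ≤ Fintype.card (V i))
    (hdistinct : ∀ i j, i ≠ j → ¬ Nonempty (F i ≃g F j))
    (h₁ : ¬ RainbowIndex.HasMember F (SimpleGraph.pathGraph 3))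
    (h₂ : ∀ r : ℕ, 3 ≤ r →
      ¬ (RainbowIndex.HasMember F (RainbowIndex.star r) ∧
        RainbowIndex.HasMember F (SimpleGraph.pathGraph 4))) :
    RainbowIndex.HasRainbowBound F ↔
      ∃ σ : Equiv.Perm (Fin 3), ∃ r s l : ℕ, 3 ≤ r ∧ 3 ≤ s ∧ 4 < l ∧
        Nonempty (F (σ 0) ≃g RainbowIndex.star r) ∧
        (F (σ 1)).IsIndContained (RainbowIndex.hairyComplete s) ∧
        Nonempty (F (σ 2) ≃g SimpleGraph.pathGraph l) := by
  constructor
  · rintro ⟨C, hC⟩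
    -- Walks from the centre have length at most `1`, so `sdiam_3` is at most `3 * 2 = 6`, below
    -- `7`. For `K_n^h` the radius bound is `2`, which gives `12` and the constant `13`.
    obtain ⟨i, hi⟩ := RainbowIndex.HasRainbowBound.exists_isIndContained hC
      (G := RainbowIndex.star (C + 7)) (by simp; omega)
      (RainbowIndex.connected_of_walk (RainbowIndex.star_walk _)) (by
        have := RainbowIndex.le_rainbowIndex_star (n := C + 7) (by omega)
        have := RainbowIndex.steinerDiam_le_of_walk (k := 3) (by omega)
          (RainbowIndex.exists_walk_of_centre (RainbowIndex.star_walk (C + 7)))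
        omega)
    obtain ⟨j, hj⟩ := RainbowIndex.HasRainbowBound.exists_isIndContained hC
      (G := RainbowIndex.hairyComplete (C + 13)) (by simp; omega)
      (RainbowIndex.connected_of_walk (RainbowIndex.hairyComplete_walk ⟨0, by omega⟩)) (by
        have := RainbowIndex.le_rainbowIndex_hairyComplete (n := C + 13) (by omega)
        have := RainbowIndex.steinerDiam_le_of_walk (k := 3) (by omega)
          (RainbowIndex.exists_walk_of_centre
            (RainbowIndex.hairyComplete_walk (n := C + 13) ⟨0, by omega⟩))
        omega)
    -- The cycle must exceed every member in size, so that an embedded member is a proper subgraph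
    -- and hence a path; `C + 3 ≤ m` yields `2m + C < 3m - 2`.
    obtain ⟨m, hm, hmC⟩ : ∃ m, (∀ i, Fintype.card (V i) < 3 * m) ∧ C + 3 ≤ m := by
      refine ⟨C + 3 + ∑ i, Fintype.card (V i), fun i => ?_, by omega⟩
      have := Finset.single_le_sum (f := fun i => Fintype.card (V i)) (fun _ _ => Nat.zero_le _)
        (Finset.mem_univ i)
      omega
    have : NeZero (3 * m) := ⟨by omega⟩
    obtain ⟨k, hk⟩ := RainbowIndex.HasRainbowBound.exists_isIndContained hC
      (G := RainbowIndex.cycle (3 * m)) (by simp; omega)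
      (RainbowIndex.cycle_connected (by omega)) (by
        have := RainbowIndex.le_rainbowIndex_cycle (n := 3 * m) (by omega)
        have := RainbowIndex.steinerDiam_cycle_le (m := m) (by omega)
        omega)
    have hci := hcard i
    obtain ⟨istar⟩ := RainbowIndex.nonempty_iso_star (hconn i) (by omega) hi
    obtain ⟨kpath⟩ := RainbowIndex.nonempty_iso_pathGraph_of_cycle (hconn k) (hm k) hk
    have hr : 3 ≤ Fintype.card (V i) - 1 := by
      by_contra hlt
      rw [show Fintype.card (V i) - 1 = 2 by omega] at istar
      obtain ⟨e⟩ := RainbowIndex.nonempty_star_two_iso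
      exact h₁ ⟨i, ⟨istar.trans e⟩⟩
    have hl : 5 ≤ Fintype.card (V k) := by
      have hck := hcard k
      by_contra hlt
      rcases (by omega : Fintype.card (V k) = 3 ∨ Fintype.card (V k) = 4) with h | h
      · exact h₁ ⟨k, ⟨h ▸ kpath⟩⟩
      · exact h₂ _ hr ⟨⟨i, ⟨istar⟩⟩, ⟨k, ⟨h ▸ kpath⟩⟩⟩
    have hstar : (RainbowIndex.star 3).IsIndContained (F i) :=
      (RainbowIndex.star_mono hr).trans ⟨istar.symm.toEmbedding⟩
    have hij : i ≠ j := by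
      rintro rfl
      exact RainbowIndex.not_star_three_isIndContained_hairyComplete _ (hstar.trans hj)
    have hik : i ≠ k := by
      rintro rfl
      exact RainbowIndex.not_star_three_isIndContained_pathGraph _
        (hstar.trans ⟨kpath.toEmbedding⟩)
    have hjk : j ≠ k := by
      rintro rfl
      exact RainbowIndex.not_pathGraph_isIndContained_hairyComplete hl _
        (SimpleGraph.IsIndContained.trans ⟨kpath.symm.toEmbedding⟩ hj)
    have hinj : Function.Injective ![i, j, k] := by
      intro a b hab
      fin_cases a <;> fin_cases b <;> simp_all
    exact ⟨Equiv.ofBijective _ (Finite.injective_iff_bijective.1 hinj), _, _, _, hr,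
      by omega, hl, ⟨istar⟩, hj, ⟨kpath⟩⟩
  · rintro ⟨σ, r, s, l, -, -, -, ⟨e₀⟩, h₁, ⟨e₂⟩⟩
    obtain ⟨N, hN⟩ := RainbowIndex.exists_rainbowIndex_bound.{0} r s l
    refine ⟨N, fun W _ G _ hG hfree => (hN hG (fun h => hfree (σ 0) ?_)
      -- The Steiner diameter is simply dropped: `rx_3` is at most `N` on its own.
      (fun h => hfree (σ 1) (h₁.trans h)) (fun h => hfree (σ 2) ?_)).trans (Nat.le_add_left _ _)⟩
    · exact SimpleGraph.IsIndContained.trans ⟨e₀.toEmbedding⟩ h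
    · exact SimpleGraph.IsIndContained.trans ⟨e₂.toEmbedding⟩ h
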